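/- Throughout, rings and algebras are associative but not necessarily unital. A ring $R$ with center $Z(R)$ is called *centrally essential* if either $R$ is commutative or for every $a\in R\setminus Z(R)$ there are non-zero $x,y\in Z(R)$ with $ax=y$. For a semigroup $S$ and a field $F$, $FS$ denotes the semigroup algebra. A *group of fractions* of a cancellative semigroup $S$ is a group $G_S$ containing $S$ as a subsemigroup such that $G_S=SS^{-1}=S^{-1}S$ (it is unique up to isomorphism over $S$ if it exists). If $S$ has a zero $\theta$, the *contracted semigroup algebra* is $F_0S=FS/F\theta$. **Theorem 1.1.** 1. Let $S$ be a (non-empty) cancellative semigroup and let $F$ be a field. The semigroup algebra $FS$ is centrally essential if and only if $S$ has a group of fractions $G_S$ and the group algebra $FG_S$ is centrally essential. 2. There exist non-commutative centrally essential semigroup algebras over fields of characteristic $0$. More precisely, let $F$ be any field of characteristic $0$ and let $\mathcal R\subset M_7(F)$ be the subalgebra of all matrices $$\begin{pmatrix} \alpha & a & b & c & d & e & f\\ 0 & \alpha & 0 & b & 0 & 0 & d\\ 0 & 0 & \alpha & 0 & 0 & 0 & e\\ 0 & 0 & 0 & \alpha & 0 & 0 & 0\\ 0 & 0 & 0 &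 0 & \alpha & 0 & a\\ 0 & 0 & 0 & 0 & 0 & \alpha & b\\ 0 & 0 & 0 & 0 & 0 & 0 & \alpha \end{pmatrix},\qquad \alpha,a,b,c,d,e,f\in F.$$ Let $e_\alpha,e_a,\dots,e_f\in\mathcal R$ be the matrices obtained by setting the indicated parameter equal to $1$ and all the others equal to $0$, and let $\theta$ be the zero matrix. Then $S=\{e_\alpha,e_a,e_b,e_c,e_d,e_e,e_f,\theta\}$ is a non-cancellative semigroup under matrix multiplication, its semigroup algebra $FS$ is non-commutative and centrally essential, $\mathcal R$ is non-commutative and centrally essential, and there is an isomorphism of $F$-algebras $F_0S\cong\mathcal R$ sending the class of each $s\in S$ to the matrix $s$. -/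

import Mathlib

universe u v

namespace CentEss

/-- An associative, not necessarily unital ring is centrally essential if it is commutative, or
if for every non-central `a` there are non-zero central `x`, `y` with `a * x = y`. -/
def IsCentrallyEssential (R : Type*) [NonUnitalRing R] : Prop :=
  (∀ a b : R, a * b = b * a) ∨
    ∀ a : R, a ∉ Set.center R →
      ∃ x ∈ Set.center R, ∃ y ∈ Set.center R, x ≠ 0 ∧ y ≠ 0 ∧ a * x = y

/-- `ι : S → G` exhibits the group `G` as the (two-sided) group of fractions of the semigroup `S`:
`ι` is an embedding and `G = S⁻¹S = SS⁻¹`. -/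
structure IsGroupOfFractions {S G : Type*} [Semigroup S] [Group G] (ι : S →ₙ* G) : Prop where
  injective : Function.Injective ι
  exists_left : ∀ g : G, ∃ a b : S, g = (ι a)⁻¹ * ι b
  exists_right : ∀ g : G, ∃ c d : S, g = ι c * (ι d)⁻¹

/-- For a semigroup `S` with zero `θ`, the ideal `Fθ` of the semigroup algebra `FS`. -/
noncomputable def zeroIdeal (F S : Type*) [Field F] [SemigroupWithZero S] :
    TwoSidedIdeal (MonoidAlgebra F S) :=
  TwoSidedIdeal.mk' (Set.range fun r : F => MonoidAlgebra.single (0 : S) r)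
    ⟨0, by simp⟩
    (by rintro _ _ ⟨r, rfl⟩ ⟨s, rfl⟩; exact ⟨r + s, by simp⟩)
    (by rintro _ ⟨r, rfl⟩; exact ⟨-r, by simp⟩)
    (by
      rintro x _ ⟨r, rfl⟩
      induction x using MonoidAlgebra.induction_linear with
      | zero => exact ⟨0, by simp⟩
      | add f g hf hg =>
        obtain ⟨p, hp⟩ := hf
        obtain ⟨q, hq⟩ := hg
        exact ⟨p + q, by simp only [add_mul, ← hp, ← hq, MonoidAlgebra.single_add]⟩
      | single a b => exact ⟨b * r, by simp⟩)
    (by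
      rintro _ x ⟨r, rfl⟩
      induction x using MonoidAlgebra.induction_linear with
      | zero => exact ⟨0, by simp⟩
      | add f g hf hg =>
        obtain ⟨p, hp⟩ := hf
        obtain ⟨q, hq⟩ := hg
        exact ⟨p + q, by simp only [mul_add, ← hp, ← hq, MonoidAlgebra.single_add]⟩
      | single a b => exact ⟨r * b, by simp⟩)

/-- The contracted semigroup algebra `F₀S = FS / Fθ` of a semigroup `S` with zero `θ`. -/
abbrev ContractedSemigroupAlgebra (F S : Type*) [Field F] [SemigroupWithZero S] : Type _ :=
  (zeroIdeal F S).ringCon.Quotient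

/-- The matrix with parameters `α, a, b, c, d, e, f`. -/
def mat {F : Type*} [Field F] (α a b c d e f : F) : Matrix (Fin 7) (Fin 7) F :=
  !![α, a, b, c, d, e, f;
     0, α, 0, b, 0, 0, d;
     0, 0, α, 0, 0, 0, e;
     0, 0, 0, α, 0, 0, 0;
     0, 0, 0, 0, α, 0, a;
     0, 0, 0, 0, 0, α, b;
     0, 0, 0, 0, 0, 0, α]

theorem mat_zero {F : Type*} [Field F] : mat (0 : F) 0 0 0 0 0 0 = 0 := by
  ext i j; fin_cases i <;> fin_cases j <;> rfl

theorem mat_scalar {F : Type*} [Field F] (r : F) :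
    mat r 0 0 0 0 0 0 = algebraMap F (Matrix (Fin 7) (Fin 7) F) r := by
  ext i j; fin_cases i <;> fin_cases j <;> simp [mat, Matrix.algebraMap_matrix_apply]

theorem mat_add {F : Type*} [Field F] (α a b c d e f α' a' b' c' d' e' f' : F) :
    mat α a b c d e f + mat α' a' b' c' d' e' f' =
      mat (α + α') (a + a') (b + b') (c + c') (d + d') (e + e') (f + f') := by
  ext i j; fin_cases i <;> fin_cases j <;> simp [mat]

theorem mat_mul {F : Type*} [Field F] (α a b c d e f α' a' b' c' d' e' f' : F) :
    mat α a b c d e f * mat α' a' b' c' d' e' f' =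
      mat (α * α') (α * a' + a * α') (α * b' + b * α') (α * c' + a * b' + c * α')
        (α * d' + d * α') (α * e' + e * α')
        (α * f' + a * d' + b * e' + d * a' + e * b' + f * α') := by
  ext i j; fin_cases i <;> fin_cases j <;>
    simp [mat, Matrix.mul_apply, Fin.sum_univ_succ] <;> ring

/-- The algebra of all matrices `mat α a b c d e f`. -/
def matAlgebra (F : Type*) [Field F] : Subalgebra F (Matrix (Fin 7) (Fin 7) F) where
  carrier := {M | ∃ α a b c d e f : F, M = mat α a b c d e f}
  mul_mem' := by
    rintro _ _ ⟨α, a, b, c, d, e, f, rfl⟩ ⟨α', a', b', c', d', e', f', rfl⟩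
    exact ⟨_, _, _, _, _, _, _, mat_mul ..⟩
  add_mem' := by
    rintro _ _ ⟨α, a, b, c, d, e, f, rfl⟩ ⟨α', a', b', c', d', e', f', rfl⟩
    exact ⟨_, _, _, _, _, _, _, mat_add ..⟩
  algebraMap_mem' r := ⟨r, 0, 0, 0, 0, 0, 0, (mat_scalar r).symm⟩

/-- The multiplicative semigroup `{e_α, e_a, e_b, e_c, e_d, e_e, e_f, θ}` of matrices, where
`e_α` is the identity matrix, each other `e_x` has parameter `x` equal to `1` and all other
parameters `0`, and `θ` is the zero matrix. -/
def matSemigroup (F : Type*) [Field F] : Submonoid (Matrix (Fin 7) (Fin 7) F) where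
  carrier := {mat 1 0 0 0 0 0 0, mat 0 1 0 0 0 0 0, mat 0 0 1 0 0 0 0, mat 0 0 0 1 0 0 0,
    mat 0 0 0 0 1 0 0, mat 0 0 0 0 0 1 0, mat 0 0 0 0 0 0 1, mat 0 0 0 0 0 0 0}
  one_mem' := by
    left
    rw [mat_scalar, map_one]
  mul_mem' := by
    rintro _ _ (rfl | rfl | rfl | rfl | rfl | rfl | rfl | rfl)
      (rfl | rfl | rfl | rfl | rfl | rfl | rfl | rfl) <;>
      simp [mat_mul]

instance (F : Type*) [Field F] : MonoidWithZero (matSemigroup F) where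
  zero := ⟨0, by simp [matSemigroup, ← mat_zero, ← Submonoid.mem_carrier]⟩
  zero_mul x := Subtype.ext (zero_mul (x : Matrix (Fin 7) (Fin 7) F))
  mul_zero x := Subtype.ext (mul_zero (x : Matrix (Fin 7) (Fin 7) F))

end CentEss

/-! # Centrally essential semigroup algebras

*Cancellative semigroups.* Let `S` be cancellative with `FS` centrally essential. For a non-central
`a ∈ S` there are non-zero central `x, y` with `a x = y`; comparing supports gives finite sets `X`
and `Y = a X = X a` in `S` with `t X = X t` and `t Y = Y t` for all `t ∈ S`. From `t Y = Y t` one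
reads off common left and right multiples of `a` and `t`, so Ore's theorem provides the group of
fractions `G` (`exists_isGroupOfFractions`). Moreover `X` and `Y` are invariant under conjugation
by `G`, so their elements, and hence `a` as a quotient of two of them, have finitely many conjugates.
The same argument applies to `G` in place of `S`. Thus, whichever of the two algebras is assumed
centrally essential, `G` has finite conjugacy classes
(`IsCentrallyEssential.finite_conjugatesOf`), and then every element of `G` has a positive power in
the center (`exists_pow_mem_center_of_finite_conjugatesOf`). So each `d ∈ S` divides an element of
`S` that is central in `G`, and elements of `FG` can be written as fractions with numerator in
`FS` and denominator a central element of `S` (`exists_central_denominator`). Clearing such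
denominators carries the property between `FS` and `FG` in both directions
(`isCentrallyEssential_iff_of_central_denominators`).

*The matrix algebra.* A matrix with `a = b = 0` is central, and multiplying any other one by a
suitable one of `e_d, e_e, e_f` gives a non-zero central matrix, so `𝓡` is centrally essential.
The top row identifies `𝓡` with the span of the non-zero elements of `S`, so the kernel of
the projection `FS → 𝓡` is `F θ`. Hence `F₀S ≅ 𝓡`, and, together with the augmentation,
`FS ≅ 𝓡 × F` (`matProjAug_bijective`), which is centrally essential because `𝓡` is.
-/

namespace CentEss

/-! ### Centrally essential rings -/

/-- The commutative alternative in the definition is redundant: a commutative ring has no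
non-central elements. -/
theorem isCentrallyEssential_iff {R : Type*} [NonUnitalRing R] :
    IsCentrallyEssential R ↔ ∀ a : R, a ∉ Set.center R →
      ∃ x ∈ Set.center R, ∃ y ∈ Set.center R, x ≠ 0 ∧ y ≠ 0 ∧ a * x = y := by
  refine ⟨?_, Or.inr⟩
  rintro (h | h) a ha
  · exact absurd (Semigroup.mem_center_iff.2 fun g => h g a) ha
  · exact h a ha

/-- Being centrally essential passes between a ring `T` and a subring `R` when every element
of `T` is a fraction `r / u` with `r ∈ R` and `u` a central non-zero-divisor of `T`. -/
theorem isCentrallyEssential_iff_of_central_denominators {R T : Type*} [NonUnitalRing R]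
    [NonUnitalRing T] (j : R →ₙ+* T) (hj : Function.Injective j)
    (hc : ∀ r, r ∈ Set.center R ↔ j r ∈ Set.center T)
    (hu : ∀ t : T, ∃ u ∈ Set.center T, (∀ s : T, s * u = 0 → s = 0) ∧ ∃ r, t * u = j r) :
    IsCentrallyEssential R ↔ IsCentrallyEssential T := by
  rw [isCentrallyEssential_iff, isCentrallyEssential_iff]
  constructor
  · intro h t ht
    obtain ⟨u, huc, hreg, r, hr⟩ := hu t
    have hrc : r ∉ Set.center R := by
      intro hrc
      rw [hc, ← hr] at hrc
      refine ht (Semigroup.mem_center_iff.2 fun g => sub_eq_zero.1 (hreg _ ?_))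
      have h1 := Semigroup.mem_center_iff.1 hrc g
      have h2 := Semigroup.mem_center_iff.1 huc g
      rw [sub_mul, sub_eq_zero, mul_assoc, h1, mul_assoc, mul_assoc, h2]
    obtain ⟨x, hx, y, hy, hx0, hy0, hxy⟩ := h r hrc
    refine ⟨u * j x, Set.mul_mem_center huc ((hc x).1 hx), j y, (hc y).1 hy, ?_,
      (map_ne_zero_iff j hj).2 hy0, by rw [← mul_assoc, hr, ← map_mul, hxy]⟩
    intro h0
    rw [← Semigroup.mem_center_iff.1 huc] at h0
    exact (map_ne_zero_iff j hj).2 hx0 (hreg _ h0)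
  · intro h r hr
    obtain ⟨x, hx, y, hy, hx0, hy0, hxy⟩ := h (j r) (mt (hc r).2 hr)
    obtain ⟨u, huc, hreg, x', hx'⟩ := hu x
    have hy' : y * u = j (r * x') := by rw [← hxy, mul_assoc, hx', map_mul]
    refine ⟨x', ?_, r * x', ?_, ?_, ?_, rfl⟩
    · rw [hc, ← hx']
      exact Set.mul_mem_center hx huc
    · rw [hc, ← hy']
      exact Set.mul_mem_center hy huc
    · rintro rfl
      exact hx0 (hreg _ (by rw [hx', map_zero]))
    · intro h0
      exact hy0 (hreg _ (by rw [hy', h0, map_zero]))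

/-- Being centrally essential is invariant under ring isomorphism. -/
theorem isCentrallyEssential_iff_of_bijective {R T : Type*} [NonUnitalRing R] [Ring T]
    (j : R →ₙ+* T) (hj : Function.Bijective j) :
    IsCentrallyEssential R ↔ IsCentrallyEssential T := by
  refine isCentrallyEssential_iff_of_central_denominators j hj.1 (fun r => ?_) fun t =>
    ⟨1, Set.one_mem_center, fun s hs => by rwa [mul_one] at hs, ?_⟩
  · simp only [Semigroup.mem_center_iff, hj.2.forall, ← map_mul, hj.1.eq_iff]
  · obtain ⟨r, rfl⟩ := hj.2 t
    exact ⟨r, mul_one _⟩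

/-- A product with a commutative ring is centrally essential if the other factor is. -/
theorem IsCentrallyEssential.prod {R K : Type*} [Ring R] [CommRing K]
    (h : IsCentrallyEssential R) : IsCentrallyEssential (R × K) := by
  rw [isCentrallyEssential_iff] at h ⊢
  have hc : ∀ p : R × K, p ∈ Set.center (R × K) ↔ p.1 ∈ Set.center R := by
    intro p
    simp only [Semigroup.mem_center_iff]
    exact ⟨fun H g => congrArg Prod.fst (H (g, 0)),
      fun H g => Prod.ext (H g.1) (mul_comm _ _)⟩
  intro p hp
  obtain ⟨x, hx, y, hy, hx0, hy0, hxy⟩ := h p.1 (mt (hc p).2 hp)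
  exact ⟨(x, 0), (hc _).2 hx, (y, 0), (hc _).2 hy, fun h0 => hx0 (congrArg Prod.fst h0),
    fun h0 => hy0 (congrArg Prod.fst h0), Prod.ext hxy (mul_zero _)⟩

/-! ### Groups with finite conjugacy classes -/

theorem finite_conjugatesOf_mul {G : Type*} [Group G] {a b : G} (ha : (conjugatesOf a).Finite)
    (hb : (conjugatesOf b).Finite) : (conjugatesOf (a * b)).Finite := by
  refine (ha.image2 (· * ·) hb).subset fun c hc => ?_
  obtain ⟨g, rfl⟩ := isConj_iff.1 hc
  exact ⟨g * a * g⁻¹, isConj_iff.2 ⟨g, rfl⟩, g * b * g⁻¹, isConj_iff.2 ⟨g, rfl⟩,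
    by simp [mul_assoc]⟩

theorem finite_conjugatesOf_inv {G : Type*} [Group G] {a : G} (ha : (conjugatesOf a).Finite) :
    (conjugatesOf a⁻¹).Finite := by
  refine (ha.image (·⁻¹)).subset fun c hc => ?_
  obtain ⟨g, rfl⟩ := isConj_iff.1 hc
  exact ⟨g * a * g⁻¹, isConj_iff.2 ⟨g, rfl⟩, by simp [mul_assoc]⟩

theorem exists_pow_commute_of_finite_conjugatesOf {G : Type*} [Group G] (s : G) {h : G}
    (hh : (conjugatesOf h).Finite) : ∃ m : ℕ, 0 < m ∧ Commute (s ^ m) h := by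
  have := hh.to_subtype
  obtain ⟨i, j, hij, he⟩ := Finite.exists_ne_map_eq_of_infinite
    fun n : ℕ => (⟨s ^ n * h * (s ^ n)⁻¹, isConj_iff.2 ⟨s ^ n, rfl⟩⟩ : conjugatesOf h)
  have key : ∀ i j : ℕ, i < j → s ^ i * h * (s ^ i)⁻¹ = s ^ j * h * (s ^ j)⁻¹ →
      ∃ m : ℕ, 0 < m ∧ Commute (s ^ m) h := by
    intro i j hlt he
    obtain ⟨k, rfl⟩ := Nat.exists_eq_add_of_lt hlt
    refine ⟨k + 1, k.succ_pos, ?_⟩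
    rw [add_assoc, pow_add] at he
    have h1 : h = s ^ (k + 1) * h * (s ^ (k + 1))⁻¹ := by
      have := congrArg (fun z => (s ^ i)⁻¹ * z * s ^ i) he
      simpa [mul_assoc] using this
    exact (eq_mul_inv_iff_mul_eq.1 h1).symm
  rcases hij.lt_or_gt with hlt | hlt
  · exact key i j hlt (congrArg Subtype.val he)
  · exact key j i hlt (congrArg Subtype.val he).symm

/-- In a group with finite conjugacy classes, the quotient by the center is torsion: a common
exponent that centralizes the finitely many conjugators of `s` works, because every element is
such a conjugator times an element of the centralizer of `s`. -/
theorem exists_pow_mem_center_of_finite_conjugatesOf {G : Type*} [Group G]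
    (hG : ∀ g : G, (conjugatesOf g).Finite) (s : G) :
    ∃ m : ℕ, 0 < m ∧ ∀ g : G, Commute (s ^ m) g := by
  have hconj : ∀ c : conjugatesOf s, ∃ g : G, g * s * g⁻¹ = c := fun c => isConj_iff.1 c.2
  choose t ht using hconj
  choose m hm0 hm using fun c : conjugatesOf s =>
    exists_pow_commute_of_finite_conjugatesOf s (hG (t c))
  have := (hG s).fintype
  refine ⟨∏ c, m c, Finset.prod_pos fun c _ => hm0 c, fun g => ?_⟩
  set c : conjugatesOf s := ⟨g * s * g⁻¹, isConj_iff.2 ⟨g, rfl⟩⟩ with hc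
  have h1 : Commute (s ^ ∏ c, m c) (t c) := by
    obtain ⟨k, hk⟩ := Finset.dvd_prod_of_mem m (Finset.mem_univ c)
    rw [hk, pow_mul]
    exact (hm c).pow_left k
  have h2 : Commute s ((t c)⁻¹ * g) := by
    have h3 : t c * s * (t c)⁻¹ = g * s * g⁻¹ := ht c
    have h4 : s = (t c)⁻¹ * (g * s * g⁻¹) * t c := by rw [← h3]; group
    change s * _ = _ * s
    nth_rewrite 1 [h4]
    group
  have h5 := h1.mul_right (h2.pow_left (∏ c, m c))
  rwa [mul_inv_cancel_left] at h5


/-! ### Groups of fractions of Ore semigroups -/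

open OreLocalization in
/-- Ore's theorem for cancellative monoids, with denominators on the left. -/
theorem exists_group_of_left_fractions_of_monoid {M : Type u} [Monoid M] [IsCancelMul M]
    (hore : ∀ a b : M, ∃ p q : M, p * a = q * b) :
    ∃ (G : Type u) (_ : Group G) (ι : M →* G), Function.Injective ι ∧
      ∀ g : G, ∃ a b : M, g = (ι a)⁻¹ * ι b := by
  choose p q hpq using hore
  let _ : OreSet (⊤ : Submonoid M) :=
    { ore_right_cancel := fun r₁ r₂ s h => ⟨1, by rw [mul_right_cancel h]⟩
      oreNum := fun r s => q r s
      oreDenom := fun r s => ⟨p r s, trivial⟩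
      ore_eq := fun r s => hpq r s }
  have hnum : ∀ r : M, IsUnit (numeratorHom r : OreLocalization (⊤ : Submonoid M) M) := fun r =>
    numerator_isUnit (⟨r, trivial⟩ : (⊤ : Submonoid M))
  have hfrac : ∀ (r : M) (s : (⊤ : Submonoid M)),
      numeratorHom (s : M) * (r /ₒ s) = (numeratorHom r : OreLocalization (⊤ : Submonoid M) M) :=
    fun r s => OreLocalization.mul_cancel
  have hunit : ∀ x : OreLocalization (⊤ : Submonoid M) M, IsUnit x := by
    intro x
    induction x using OreLocalization.ind with
    | _ r s =>
      have h := hnum r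
      rw [← hfrac r s] at h
      obtain ⟨v, hv⟩ := hnum (s : M)
      rw [← hv] at h
      exact (Units.isUnit_units_mul v _).1 h
  let _ : Group (OreLocalization (⊤ : Submonoid M) M) := groupOfIsUnit hunit
  refine ⟨OreLocalization (⊤ : Submonoid M) M, inferInstance, numeratorHom, ?_, ?_⟩
  · intro a b hab
    rw [numeratorHom_apply, numeratorHom_apply, oreDiv_eq_iff] at hab
    obtain ⟨u, v, h1, h2⟩ := hab
    have h3 : (u : M) = v := by simpa using h2
    have h4 : (u : M) * b = v * a := h1
    rw [← h3] at h4
    exact (mul_left_cancel h4).symm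
  · intro x
    induction x using OreLocalization.ind with
    | _ r s => exact ⟨s, r, eq_inv_mul_of_mul_eq (hfrac r s)⟩

/-- The monoid of self-maps of `S` consisting of the identity and the left translations. For a
cancellative semigroup `S` it is a cancellative monoid containing a copy of `S`; an identity is
adjoined only if `S` has none. -/
def leftTranslations (S : Type*) [Semigroup S] : Submonoid (Function.End S) where
  carrier := {f | f = 1 ∨ ∃ s : S, f = fun x => s * x}
  one_mem' := Or.inl rfl
  mul_mem' := by
    rintro _ _ (rfl | ⟨s, rfl⟩) (rfl | ⟨t, rfl⟩)
    · exact Or.inl rfl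
    · exact Or.inr ⟨t, rfl⟩
    · exact Or.inr ⟨s, rfl⟩
    · exact Or.inr ⟨s * t, funext fun x => (mul_assoc s t x).symm⟩

/-- The translation `x ↦ s * x` as an element of `leftTranslations S`. -/
def toLeftTranslations (S : Type*) [Semigroup S] : S →ₙ* leftTranslations S where
  toFun s := ⟨fun x => s * x, Or.inr ⟨s, rfl⟩⟩
  map_mul' s t := Subtype.ext (funext fun x => mul_assoc s t x)

theorem toLeftTranslations_injective (S : Type*) [Semigroup S] [IsCancelMul S] :
    Function.Injective (toLeftTranslations S) := fun s _ h =>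
  mul_right_cancel (congrFun (congrArg Subtype.val h) s)

theorem eq_one_or_eq_toLeftTranslations {S : Type*} [Semigroup S] (f : leftTranslations S) :
    f = 1 ∨ ∃ s, f = toLeftTranslations S s := by
  obtain ⟨f, rfl | ⟨s, rfl⟩⟩ := f
  · exact Or.inl rfl
  · exact Or.inr ⟨s, rfl⟩

instance (S : Type*) [Semigroup S] [IsCancelMul S] : IsCancelMul (leftTranslations S) where
  mul_left_cancel f g h hgh := by
    have hinj : Function.Injective f.1 := by
      obtain ⟨f, rfl | ⟨s, rfl⟩⟩ := f
      · exact Function.injective_id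
      · exact mul_right_injective s
    exact Subtype.ext (funext fun x => hinj (congrFun (congrArg Subtype.val hgh) x))
  mul_right_cancel g f h hfh := by
    -- A left translation that fixes one element is the identity.
    have hid : ∀ b t : S, t = b * t → ∀ x, x = b * x := by
      intro b t ht x
      have htb : t = t * b := by
        refine mul_right_cancel (b := t) ?_
        rw [mul_assoc, ← ht]
      refine mul_left_cancel (a := t) ?_
      rw [← mul_assoc, ← htb]
    rcases eq_one_or_eq_toLeftTranslations g with rfl | ⟨t, rfl⟩
    · simpa using hfh
    have hval : ∀ x, f.1 (t * x) = h.1 (t * x) := fun x => congrFun (congrArg Subtype.val hfh) x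
    obtain ⟨f, rfl | ⟨a, rfl⟩⟩ := f <;> obtain ⟨h, rfl | ⟨b, rfl⟩⟩ := h
    · rfl
    · exact Subtype.ext (funext (hid b (t * t) (hval t)))
    · exact Subtype.ext (funext fun x => (hid a (t * t) (hval t).symm x).symm)
    · obtain rfl : a = b := mul_right_cancel (hval t)
      rfl

/-- Ore's theorem: a cancellative semigroup in which any two elements have common left multiples
and common right multiples has a group of fractions. -/
theorem exists_isGroupOfFractions {S : Type u} [Semigroup S] [IsCancelMul S] [Nonempty S]
    (hl : ∀ a b : S, ∃ p q, p * a = q * b) (hr : ∀ a b : S, ∃ p q, a * p = b * q) :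
    ∃ (G : Type u) (_ : Group G) (ι : S →ₙ* G), IsGroupOfFractions ι := by
  obtain ⟨e⟩ := ‹Nonempty S›
  let j := toLeftTranslations S
  have hM : ∀ f : leftTranslations S, ∃ s, f * j e = j s := by
    intro f
    rcases eq_one_or_eq_toLeftTranslations f with rfl | ⟨s, rfl⟩
    · exact ⟨e, one_mul _⟩
    · exact ⟨s * e, (map_mul j s e).symm⟩
  have hM' : ∀ f : leftTranslations S, ∃ s, j e * f = j s := by
    intro f
    rcases eq_one_or_eq_toLeftTranslations f with rfl | ⟨s, rfl⟩
    · exact ⟨e, mul_one _⟩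
    · exact ⟨e * s, (map_mul j e s).symm⟩
  obtain ⟨G, _, κ, hκ, hfrac⟩ := exists_group_of_left_fractions_of_monoid
    (M := leftTranslations S) (by
      intro f g
      obtain ⟨a, ha⟩ := hM' f
      obtain ⟨b, hb⟩ := hM' g
      obtain ⟨p, q, hpq⟩ := hl a b
      refine ⟨j p * j e, j q * j e, ?_⟩
      rw [mul_assoc, mul_assoc, ha, hb, ← map_mul, hpq, map_mul])
  let ι : S →ₙ* G := (κ : leftTranslations S →ₙ* G).comp j
  have hleft : ∀ g : G, ∃ a b : S, g = (ι a)⁻¹ * ι b := by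
    intro g
    obtain ⟨f, h, rfl⟩ := hfrac g
    obtain ⟨a, ha⟩ := hM' f
    obtain ⟨b, hb⟩ := hM' h
    refine ⟨a, b, ?_⟩
    change _ = (κ (j a))⁻¹ * κ (j b)
    rw [← ha, ← hb, map_mul, map_mul]
    group
  refine ⟨G, inferInstance, ι, hκ.comp (toLeftTranslations_injective S), hleft, fun g => ?_⟩
  obtain ⟨a, b, rfl⟩ := hleft g
  obtain ⟨p, q, hpq⟩ := hr a b
  refine ⟨p, q, ?_⟩
  rw [inv_mul_eq_iff_eq_mul, ← mul_assoc, ← map_mul, hpq, map_mul, mul_inv_cancel_right]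


/-! ### Central elements of semigroup algebras -/

open MonoidAlgebra

/-- The support `X` of a central element of the algebra of a cancellative semigroup satisfies
`t X ⊆ X t` for all `t`. -/
theorem exists_mem_support_mul_eq_mul {F S : Type*} [Field F] [Semigroup S] [IsCancelMul S]
    {x : MonoidAlgebra F S} (hx : x ∈ Set.center (MonoidAlgebra F S)) (t : S) {u : S}
    (hu : u ∈ x.coeff.support) : ∃ v ∈ x.coeff.support, t * u = v * t := by
  have h : (single t (1 : F) * x).coeff.support = (x * single t (1 : F)).coeff.support := by
    rw [Semigroup.mem_center_iff.1 hx]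
  have hmem : t * u ∈ (single t (1 : F) * x).coeff.support := by
    rw [support_coeff_single_mul _ _ (by simp)]
    exact Finset.mem_map.2 ⟨u, hu, rfl⟩
  rw [h, support_coeff_mul_single _ _ (by simp)] at hmem
  obtain ⟨v, hv, hvt⟩ := Finset.mem_map.1 hmem
  exact ⟨v, hv, hvt.symm⟩

/-- The support `X` of a central element of the algebra of a cancellative semigroup satisfies
`X t ⊆ t X` for all `t`. -/
theorem exists_mem_support_mul_eq_mul' {F S : Type*} [Field F] [Semigroup S] [IsCancelMul S]
    {x : MonoidAlgebra F S} (hx : x ∈ Set.center (MonoidAlgebra F S)) (t : S) {u : S}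
    (hu : u ∈ x.coeff.support) : ∃ v ∈ x.coeff.support, u * t = t * v := by
  have h : (single t (1 : F) * x).coeff.support = (x * single t (1 : F)).coeff.support := by
    rw [Semigroup.mem_center_iff.1 hx]
  have hmem : u * t ∈ (x * single t (1 : F)).coeff.support := by
    rw [support_coeff_mul_single _ _ (by simp)]
    exact Finset.mem_map.2 ⟨u, hu, rfl⟩
  rw [← h, support_coeff_single_mul _ _ (by simp)] at hmem
  obtain ⟨v, hv, hvt⟩ := Finset.mem_map.1 hmem
  exact ⟨v, hv, hvt.symm⟩

/-- In a centrally essential algebra of a cancellative semigroup, a non-central `a ∈ S` maps the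
support of some non-zero central element onto the support of another one. -/
theorem IsCentrallyEssential.exists_central_support {F S : Type*} [Field F] [Semigroup S]
    [IsCancelMul S] (h : IsCentrallyEssential (MonoidAlgebra F S)) (a : S) :
    (∀ t, t * a = a * t) ∨ ∃ x ∈ Set.center (MonoidAlgebra F S),
      ∃ y ∈ Set.center (MonoidAlgebra F S), x.coeff.support.Nonempty ∧
        (∀ w, w ∈ y.coeff.support ↔ ∃ u ∈ x.coeff.support, a * u = w) ∧
        ∀ w, w ∈ y.coeff.support ↔ ∃ u ∈ x.coeff.support, u * a = w := by
  rw [isCentrallyEssential_iff] at h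
  by_cases ha : single a (1 : F) ∈ Set.center (MonoidAlgebra F S)
  · left
    intro t
    have := Semigroup.mem_center_iff.1 ha (single t 1)
    rw [single_mul_single, single_mul_single, mul_one] at this
    exact single_left_injective (one_ne_zero (α := F)) this
  · right
    obtain ⟨x, hx, y, hy, hx0, -, hxy⟩ := h _ ha
    refine ⟨x, hx, y, hy, ?_, fun w => ?_, fun w => ?_⟩
    · rwa [Finsupp.support_nonempty_iff, Ne, coeff_eq_zero]
    · rw [← hxy, support_coeff_single_mul _ _ (by simp)]
      exact Finset.mem_map
    · rw [← hxy, Semigroup.mem_center_iff.1 hx, support_coeff_mul_single _ _ (by simp)]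
      exact Finset.mem_map

theorem IsCentrallyEssential.exists_common_right_multiple {F S : Type*} [Field F] [Semigroup S]
    [IsCancelMul S] (h : IsCentrallyEssential (MonoidAlgebra F S)) (a t : S) :
    ∃ p q, a * p = t * q := by
  rcases h.exists_central_support a with ha | ⟨x, hx, y, hy, ⟨u, hu⟩, hY, -⟩
  · exact ⟨t, a, (ha t).symm⟩
  · obtain ⟨w, hw, hwt⟩ := exists_mem_support_mul_eq_mul hy t ((hY _).2 ⟨u, hu, rfl⟩)
    obtain ⟨u', -, rfl⟩ := (hY w).1 hw
    exact ⟨u' * t, a * u, by rw [hwt, mul_assoc]⟩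

theorem IsCentrallyEssential.exists_common_left_multiple {F S : Type*} [Field F] [Semigroup S]
    [IsCancelMul S] (h : IsCentrallyEssential (MonoidAlgebra F S)) (a t : S) :
    ∃ p q, p * a = q * t := by
  rcases h.exists_central_support a with ha | ⟨x, hx, y, hy, ⟨u, hu⟩, -, hY⟩
  · exact ⟨t, a, ha t⟩
  · obtain ⟨w, hw, hwt⟩ := exists_mem_support_mul_eq_mul' hy t ((hY _).2 ⟨u, hu, rfl⟩)
    obtain ⟨u', -, rfl⟩ := (hY w).1 hw
    exact ⟨t * u', u * a, by rw [hwt, mul_assoc]⟩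

/-- Elements of the support of a central element have finitely many conjugates in the group of
fractions: all of them lie in the support. -/
theorem finite_conjugatesOf_of_mem_support {F S G : Type*} [Field F] [Semigroup S] [IsCancelMul S]
    [Group G] {ι : S →ₙ* G} (hι : IsGroupOfFractions ι) {x : MonoidAlgebra F S}
    (hx : x ∈ Set.center (MonoidAlgebra F S)) {u : S} (hu : u ∈ x.coeff.support) :
    (conjugatesOf (ι u)).Finite := by
  refine (x.coeff.support.finite_toSet.image ι).subset fun c hc => ?_
  obtain ⟨g, rfl⟩ := isConj_iff.1 hc
  obtain ⟨p, q, rfl⟩ := hι.exists_right g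
  obtain ⟨v, hv, hvq⟩ := exists_mem_support_mul_eq_mul' hx q hu
  obtain ⟨w, hw, hwp⟩ := exists_mem_support_mul_eq_mul hx p hv
  refine ⟨w, hw, ?_⟩
  have h1 := congrArg ι hvq
  have h2 := congrArg ι hwp
  rw [map_mul, map_mul] at h1 h2
  calc ι w = ι p * ι v * (ι p)⁻¹ := by rw [h2, mul_inv_cancel_right]
    _ = ι p * ((ι q)⁻¹ * (ι u * ι q)) * (ι p)⁻¹ := by rw [h1, inv_mul_cancel_left]
    _ = _ := by group

theorem IsCentrallyEssential.finite_conjugatesOf {F S G : Type*} [Field F] [Semigroup S]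
    [IsCancelMul S] [Group G] {ι : S →ₙ* G} (hι : IsGroupOfFractions ι)
    (h : IsCentrallyEssential (MonoidAlgebra F S)) (g : G) : (conjugatesOf g).Finite := by
  have key : ∀ s : S, (conjugatesOf (ι s)).Finite := by
    intro s
    rcases h.exists_central_support s with hs | ⟨x, hx, y, hy, ⟨u, hu⟩, hY, -⟩
    · refine (Set.finite_singleton (ι s)).subset fun c hc => ?_
      obtain ⟨g, rfl⟩ := isConj_iff.1 hc
      obtain ⟨p, q, rfl⟩ := hι.exists_right g
      have hc : ∀ t, Commute (ι t) (ι s) := fun t => by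
        rw [commute_iff_eq, ← map_mul, ← map_mul, hs]
      have := ((hc p).mul_left (hc q).inv_left).eq
      rw [Set.mem_singleton_iff, this, mul_inv_cancel_right]
    · have := finite_conjugatesOf_mul
        (finite_conjugatesOf_of_mem_support hι hy ((hY _).2 ⟨u, hu, rfl⟩))
        (finite_conjugatesOf_inv (finite_conjugatesOf_of_mem_support hι hx hu))
      rwa [map_mul, mul_inv_cancel_right] at this
  obtain ⟨p, q, rfl⟩ := hι.exists_right g
  exact finite_conjugatesOf_mul (key p) (finite_conjugatesOf_inv (key q))

theorem isGroupOfFractions_id (G : Type*) [Group G] : IsGroupOfFractions (MulHom.id G) where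
  injective := Function.injective_id
  exists_left g := ⟨1, g, by simp⟩
  exists_right g := ⟨g, 1, by simp⟩

/-! ### Transfer between a semigroup and its group of fractions -/

theorem mem_center_iff_commute_single {F S : Type*} [Field F] [Semigroup S]
    {x : MonoidAlgebra F S} :
    x ∈ Set.center (MonoidAlgebra F S) ↔ ∀ s : S, Commute x (single s 1) := by
  refine ⟨fun h s => (Semigroup.mem_center_iff.1 h _).symm, fun h => ?_⟩
  refine Semigroup.mem_center_iff.2 fun g => ?_
  induction g using MonoidAlgebra.induction_linear with
  | zero => simp
  | add f g hf hg => rw [add_mul, mul_add, hf, hg]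
  | single s r =>
    have := (h s).eq
    rw [show single s r = r • single s (1 : F) by simp, smul_mul_assoc, mul_smul_comm, this]

theorem mem_center_iff_map_mem_center {F S G : Type*} [Field F] [Semigroup S] [Group G]
    {ι : S →ₙ* G} (hι : IsGroupOfFractions ι) (x : MonoidAlgebra F S) :
    x ∈ Set.center (MonoidAlgebra F S) ↔
      mapDomainNonUnitalRingHom F ι x ∈ Set.center (MonoidAlgebra F G) := by
  have hinj : Function.Injective (mapDomainNonUnitalRingHom F ι) := mapDomain_injective hι.injective
  have hsingle : ∀ s : S,
      mapDomainNonUnitalRingHom F ι (single s 1) = MonoidAlgebra.of F G (ι s) := fun s =>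
    mapDomain_single
  rw [mem_center_iff_commute_single, mem_center_iff_commute_single]
  have h : ∀ s : S, Commute x (single s 1) ↔
      Commute (mapDomainNonUnitalRingHom F ι x) (MonoidAlgebra.of F G (ι s)) := by
    intro s
    rw [← hsingle, commute_iff_eq, commute_iff_eq, ← map_mul, ← map_mul, hinj.eq_iff]
  refine ⟨fun H g => ?_, fun H s => (h s).2 (H _)⟩
  obtain ⟨p, q, rfl⟩ := hι.exists_right g
  change Commute _ (MonoidAlgebra.of F G _)
  rw [map_mul]
  refine ((h p).1 (H p)).mul_right ?_
  exact Commute.units_inv_right (u := Units.map (MonoidAlgebra.of F G) (toUnits (ι q)))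
    ((h q).1 (H q))

/-- If every element of the semigroup has a power central in the group of fractions, then every
element of the group algebra has a denominator in the semigroup that is central in the group. -/
theorem exists_central_denominator {F S G : Type*} [Field F] [Semigroup S] [Nonempty S] [Group G]
    {ι : S →ₙ* G} (hι : IsGroupOfFractions ι)
    (hpow : ∀ g : G, ∃ m : ℕ, 0 < m ∧ ∀ h : G, Commute (g ^ m) h) (a : MonoidAlgebra F G) :
    ∃ s : S, (∀ h, Commute (ι s) h) ∧
      ∃ b, a * single (ι s) 1 = mapDomainNonUnitalRingHom F ι b := by
  have hsucc : ∀ (s : S) (n : ℕ), ∃ t, ι t = ι s ^ (n + 1) := by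
    intro s n
    induction n with
    | zero => exact ⟨s, by simp⟩
    | succ n ih =>
      obtain ⟨t, ht⟩ := ih
      exact ⟨t * s, by rw [map_mul, ht, ← pow_succ]⟩
  induction a using MonoidAlgebra.induction_linear with
  | zero =>
    obtain ⟨e⟩ := ‹Nonempty S›
    obtain ⟨m, hm, hc⟩ := hpow (ι e)
    obtain ⟨n, rfl⟩ := Nat.exists_eq_add_of_lt hm
    obtain ⟨t, ht⟩ := hsucc e n
    refine ⟨t, fun h => ?_, 0, by simp⟩
    rw [ht]
    simpa using hc h
  | add f g hf hg =>
    obtain ⟨s, hs, b, hb⟩ := hf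
    obtain ⟨t, ht, c, hc⟩ := hg
    refine ⟨s * t, fun h => ?_, b * single t 1 + c * single s 1, ?_⟩
    · rw [map_mul]
      exact (hs h).mul_left (ht h)
    · have h1 : ∀ s : S, mapDomainNonUnitalRingHom F ι (single s 1) = single (ι s) 1 := fun s =>
        mapDomain_single
      have h2 : single (ι (s * t)) (1 : F) = single (ι s) 1 * single (ι t) 1 := by
        rw [single_mul_single, mul_one, map_mul]
      have h3 : single (ι (s * t)) (1 : F) = single (ι t) 1 * single (ι s) 1 := by
        rw [single_mul_single, mul_one, map_mul, (hs _).eq]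
      rw [map_add, map_mul (mapDomainNonUnitalRingHom F ι), map_mul (mapDomainNonUnitalRingHom F ι),
        h1, h1, ← hb, ← hc, add_mul, mul_assoc, mul_assoc, ← h2, ← h3]
  | single g r =>
    obtain ⟨p, q, rfl⟩ := hι.exists_right g
    obtain ⟨m, hm, hc⟩ := hpow (ι q)
    obtain ⟨n, rfl⟩ := Nat.exists_eq_add_of_lt hm
    -- An exponent at least `2` leaves a positive power of `q` after cancelling `q⁻¹`.
    obtain ⟨t, ht⟩ := hsucc q (n + 1 + n)
    obtain ⟨t', ht'⟩ := hsucc q (n + n)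
    refine ⟨t, fun h => ?_, single (p * t') r, ?_⟩
    · have h2 : ι t = ι q ^ (0 + n + 1) * ι q ^ (0 + n + 1) := by
        rw [ht, ← pow_add]
        congr 1
        omega
      rw [h2]
      exact (hc h).mul_left (hc h)
    · have h3 : ι p * (ι q)⁻¹ * ι t = ι (p * t') := by
        rw [map_mul, ht, ht', show n + 1 + n + 1 = 1 + (n + n + 1) by omega, pow_add]
        group
      rw [single_mul_single, mul_one, h3]
      exact mapDomain_single.symm

theorem isCentrallyEssential_iff_of_isGroupOfFractions {F S G : Type*} [Field F] [Semigroup S]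
    [Nonempty S] [Group G] {ι : S →ₙ* G} (hι : IsGroupOfFractions ι)
    (hfin : ∀ g : G, (conjugatesOf g).Finite) :
    IsCentrallyEssential (MonoidAlgebra F S) ↔ IsCentrallyEssential (MonoidAlgebra F G) := by
  refine isCentrallyEssential_iff_of_central_denominators (mapDomainNonUnitalRingHom F ι)
    (mapDomain_injective hι.injective) (mem_center_iff_map_mem_center hι) fun t => ?_
  obtain ⟨s, hs, b, hb⟩ := exists_central_denominator hι
    (exists_pow_mem_center_of_finite_conjugatesOf hfin) t
  refine ⟨single (ι s) 1, ?_, fun x hx => ?_, b, hb⟩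
  · rw [mem_center_iff_commute_single]
    intro g
    rw [commute_iff_eq, single_mul_single, single_mul_single, (hs g).eq]
  · have := congrArg (· * single (ι s)⁻¹ (1 : F)) hx
    simpa [mul_assoc, single_mul_single, ← one_def] using this

theorem isCentrallyEssential_iff_exists_isGroupOfFractions (S : Type u) [Semigroup S]
    [IsCancelMul S] [Nonempty S] (F : Type v) [Field F] :
    IsCentrallyEssential (MonoidAlgebra F S) ↔ ∃ (G : Type u) (_ : Group G) (ι : S →ₙ* G),
      IsGroupOfFractions ι ∧ IsCentrallyEssential (MonoidAlgebra F G) := by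
  constructor
  · intro h
    obtain ⟨G, _, ι, hι⟩ := exists_isGroupOfFractions h.exists_common_left_multiple
      h.exists_common_right_multiple
    exact ⟨G, inferInstance, ι, hι,
      (isCentrallyEssential_iff_of_isGroupOfFractions hι (h.finite_conjugatesOf hι)).1 h⟩
  · rintro ⟨G, _, ι, hι, h⟩
    exact (isCentrallyEssential_iff_of_isGroupOfFractions hι
      (h.finite_conjugatesOf (isGroupOfFractions_id G))).2 h


/-! ### The matrix algebra and the algebra of its eight-element semigroup -/

/-- The matrix `mat α a b c d e f` as an element of `matAlgebra F`. -/
def matElem {F : Type*} [Field F] (α a b c d e f : F) : matAlgebra F :=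
  ⟨mat α a b c d e f, α, a, b, c, d, e, f, rfl⟩

theorem matAlgebra_cases {F : Type*} [Field F] (m : matAlgebra F) :
    ∃ α a b c d e f : F, m = matElem α a b c d e f := by
  obtain ⟨_, α, a, b, c, d, e, f, rfl⟩ := m
  exact ⟨α, a, b, c, d, e, f, rfl⟩

theorem matElem_mul {F : Type*} [Field F] (α a b c d e f α' a' b' c' d' e' f' : F) :
    matElem α a b c d e f * matElem α' a' b' c' d' e' f' =
      matElem (α * α') (α * a' + a * α') (α * b' + b * α') (α * c' + a * b' + c * α')
        (α * d' + d * α') (α * e' + e * α')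
        (α * f' + a * d' + b * e' + d * a' + e * b' + f * α') :=
  Subtype.ext (mat_mul ..)

theorem matElem_inj {F : Type*} [Field F] {α a b c d e f α' a' b' c' d' e' f' : F} :
    matElem α a b c d e f = matElem α' a' b' c' d' e' f' ↔
      α = α' ∧ a = a' ∧ b = b' ∧ c = c' ∧ d = d' ∧ e = e' ∧ f = f' := by
  refine ⟨fun h => ?_, by rintro ⟨rfl, rfl, rfl, rfl, rfl, rfl, rfl⟩; rfl⟩
  have h0 := fun j => congrFun (congrFun (congrArg Subtype.val h) 0) j
  exact ⟨h0 0, h0 1, h0 2, h0 3, h0 4, h0 5, h0 6⟩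

/-- An element of `matAlgebra F` is determined by its top row. -/
theorem matAlgebra_ext {F : Type*} [Field F] {m n : matAlgebra F}
    (h : ∀ j, (m : Matrix (Fin 7) (Fin 7) F) 0 j = (n : Matrix (Fin 7) (Fin 7) F) 0 j) : m = n := by
  obtain ⟨α, a, b, c, d, e, f, rfl⟩ := matAlgebra_cases m
  obtain ⟨α', a', b', c', d', e', f', rfl⟩ := matAlgebra_cases n
  exact matElem_inj.2 ⟨h 0, h 1, h 2, h 3, h 4, h 5, h 6⟩

theorem matElem_eq_zero {F : Type*} [Field F] {α a b c d e f : F} :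
    matElem α a b c d e f = 0 ↔
      α = 0 ∧ a = 0 ∧ b = 0 ∧ c = 0 ∧ d = 0 ∧ e = 0 ∧ f = 0 := by
  rw [← matElem_inj, show matElem (0 : F) 0 0 0 0 0 0 = 0 from Subtype.ext mat_zero]

/-- The only entry of `matElem` whose product formula is not symmetric is `c`, and it involves
only the parameters `a` and `b`. -/
theorem matElem_mem_center {F : Type*} [Field F] (α c d e f : F) :
    matElem α 0 0 c d e f ∈ Set.center (matAlgebra F) := by
  refine Semigroup.mem_center_iff.2 fun g => ?_
  obtain ⟨α', a', b', c', d', e', f', rfl⟩ := matAlgebra_cases g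
  rw [matElem_mul, matElem_mul, matElem_inj]
  refine ⟨?_, ?_, ?_, ?_, ?_, ?_, ?_⟩ <;> ring

theorem not_commutative_matAlgebra (F : Type*) [Field F] :
    ¬ ∀ x y : matAlgebra F, x * y = y * x := by
  intro h
  have := h (matElem 0 1 0 0 0 0 0) (matElem 0 0 1 0 0 0 0)
  rw [matElem_mul, matElem_mul, matElem_inj] at this
  simp at this

theorem isCentrallyEssential_matAlgebra (F : Type*) [Field F] :
    IsCentrallyEssential (matAlgebra F) := by
  rw [isCentrallyEssential_iff]
  intro m hm
  obtain ⟨α, a, b, c, d, e, f, rfl⟩ := matAlgebra_cases m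
  -- It suffices to find central parameters `d'`, `e'`, `f'` whose product with `m` does not vanish.
  have key : ∀ d' e' f' : F, matElem α a b c d e f * matElem 0 0 0 0 d' e' f' ≠ 0 →
      ∃ x ∈ Set.center (matAlgebra F), ∃ y ∈ Set.center (matAlgebra F),
        x ≠ 0 ∧ y ≠ 0 ∧ matElem α a b c d e f * x = y := by
    intro d' e' f' h
    refine ⟨_, matElem_mem_center 0 0 d' e' f', _, ?_, right_ne_zero_of_mul h, h, rfl⟩
    rw [matElem_mul]
    simpa using matElem_mem_center _ _ _ _ _
  by_cases hα : α = 0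
  · by_cases ha : a = 0
    · have hb : b ≠ 0 := by
        rintro rfl
        subst ha
        exact hm (matElem_mem_center ..)
      exact key 0 1 0 (by simp [matElem_mul, matElem_eq_zero, hb])
    · exact key 1 0 0 (by simp [matElem_mul, matElem_eq_zero, ha])
  · exact key 0 0 1 (by simp [matElem_mul, matElem_eq_zero, hα])

/-- The linear extension of the inclusion of the matrix semigroup into the matrix algebra. -/
noncomputable def matProj (F : Type*) [Field F] :
    MonoidAlgebra F (matSemigroup F) →ₐ[F] matAlgebra F :=
  MonoidAlgebra.lift F (matAlgebra F) (matSemigroup F)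
    { toFun := fun s => ⟨s, by
        obtain ⟨s, rfl | rfl | rfl | rfl | rfl | rfl | rfl | rfl⟩ := s <;>
          exact ⟨_, _, _, _, _, _, _, rfl⟩⟩
      map_one' := rfl
      map_mul' := fun _ _ => rfl }

theorem coe_matProj_single {F : Type*} [Field F] (s : matSemigroup F) (r : F) :
    (matProj F (single s r) : Matrix (Fin 7) (Fin 7) F) = r • (s : Matrix (Fin 7) (Fin 7) F) := by
  simp [matProj, MonoidAlgebra.lift_single]

theorem matProj_single_zero {F : Type*} [Field F] (r : F) : matProj F (single 0 r) = 0 := by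
  apply Subtype.ext
  rw [coe_matProj_single]
  exact smul_zero r

/-- The seven non-zero elements `e_α, e_a, …, e_f` of the matrix semigroup, indexed by the column
of the parameter in the top row. -/
def matGen (F : Type*) [Field F] (i : Fin 7) : matSemigroup F :=
  ⟨![mat 1 0 0 0 0 0 0, mat 0 1 0 0 0 0 0, mat 0 0 1 0 0 0 0, mat 0 0 0 1 0 0 0,
    mat 0 0 0 0 1 0 0, mat 0 0 0 0 0 1 0, mat 0 0 0 0 0 0 1] i, by
    fin_cases i <;> simp [matSemigroup, ← Submonoid.mem_carrier]⟩

theorem eq_matGen_or_eq_zero {F : Type*} [Field F] (s : matSemigroup F) :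
    (∃ i, s = matGen F i) ∨ s = 0 := by
  obtain ⟨s, rfl | rfl | rfl | rfl | rfl | rfl | rfl | rfl⟩ := s
  exacts [Or.inl ⟨0, rfl⟩, Or.inl ⟨1, rfl⟩, Or.inl ⟨2, rfl⟩, Or.inl ⟨3, rfl⟩, Or.inl ⟨4, rfl⟩,
    Or.inl ⟨5, rfl⟩, Or.inl ⟨6, rfl⟩, Or.inr (Subtype.ext mat_zero)]

theorem matGen_zero_apply {F : Type*} [Field F] (i j : Fin 7) :
    (matGen F i : Matrix (Fin 7) (Fin 7) F) 0 j = if i = j then 1 else 0 := by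
  fin_cases i <;> fin_cases j <;> rfl

/-- The linear section of `matProj` that writes a matrix as a combination of the seven non-zero
elements of the semigroup; the coefficients are the entries of the top row. -/
noncomputable def matSection (F : Type*) [Field F] :
    matAlgebra F →ₗ[F] MonoidAlgebra F (matSemigroup F) where
  toFun m := ∑ i, single (matGen F i) (m.1 0 i)
  map_add' m n := by simp [Finset.sum_add_distrib]
  map_smul' r m := by simp [Finset.smul_sum]

theorem matSection_apply {F : Type*} [Field F] (m : matAlgebra F) :
    matSection F m = ∑ i, single (matGen F i) (m.1 0 i) := rfl

theorem matProj_matSection {F : Type*} [Field F] (m : matAlgebra F) :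
    matProj F (matSection F m) = m := by
  refine matAlgebra_ext fun j => ?_
  rw [matSection_apply, map_sum, AddSubmonoidClass.coe_finsetSum, Matrix.sum_apply,
    Finset.sum_eq_single j (fun i _ hi => ?_) (by simp)]
  · rw [coe_matProj_single, Matrix.smul_apply, matGen_zero_apply, if_pos rfl, smul_eq_mul, mul_one]
  · rw [coe_matProj_single, Matrix.smul_apply, matGen_zero_apply, if_neg hi, smul_zero]

/-- The matrix of `x` determines `x` up to a multiple of the zero `θ` of the semigroup. -/
theorem exists_eq_matSection_matProj_add {F : Type*} [Field F]
    (x : MonoidAlgebra F (matSemigroup F)) :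
    ∃ r : F, x = matSection F (matProj F x) + single 0 r := by
  induction x using MonoidAlgebra.induction_linear with
  | zero => exact ⟨0, by simp⟩
  | add f g hf hg =>
    obtain ⟨r, hr⟩ := hf
    obtain ⟨t, ht⟩ := hg
    refine ⟨r + t, ?_⟩
    rw [map_add, map_add, single_add]
    nth_rewrite 1 [hr, ht]
    abel
  | single s r =>
    rcases eq_matGen_or_eq_zero s with ⟨i, rfl⟩ | rfl
    · refine ⟨0, ?_⟩
      rw [matSection_apply, single_zero, add_zero,
        Finset.sum_eq_single i (fun j _ hj => ?_) (by simp)]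
      · rw [coe_matProj_single, Matrix.smul_apply, matGen_zero_apply]
        simp
      · rw [coe_matProj_single, Matrix.smul_apply, matGen_zero_apply, if_neg (Ne.symm hj)]
        simp
    · exact ⟨r, by rw [matProj_single_zero, map_zero, zero_add]⟩

theorem matProj_eq_zero_iff {F : Type*} [Field F] (x : MonoidAlgebra F (matSemigroup F)) :
    matProj F x = 0 ↔ ∃ r : F, x = single 0 r := by
  constructor
  · intro h
    obtain ⟨r, hr⟩ := exists_eq_matSection_matProj_add x
    exact ⟨r, by rwa [h, map_zero, zero_add] at hr⟩
  · rintro ⟨r, rfl⟩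
    exact matProj_single_zero r

/-- Pairing the projection to the matrix algebra with the augmentation gives an isomorphism
`FS ≅ 𝓡 × F`. -/
noncomputable def matProjAug (F : Type*) [Field F] :
    MonoidAlgebra F (matSemigroup F) →ₐ[F] matAlgebra F × F :=
  (matProj F).prod (MonoidAlgebra.lift F F (matSemigroup F) 1)

theorem matProjAug_bijective (F : Type*) [Field F] : Function.Bijective (matProjAug F) := by
  constructor
  · rw [injective_iff_map_eq_zero]
    intro x hx
    obtain ⟨r, rfl⟩ := (matProj_eq_zero_iff x).1 (congrArg Prod.fst hx)
    have h : MonoidAlgebra.lift F F (matSemigroup F) 1 (single 0 r) = 0 := congrArg Prod.snd hx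
    rw [MonoidAlgebra.lift_single] at h
    simp_all
  · rintro ⟨m, t⟩
    refine ⟨matSection F m +
      single 0 (t - MonoidAlgebra.lift F F (matSemigroup F) 1 (matSection F m)), ?_⟩
    refine Prod.ext ?_ ?_
    · change matProj F _ = m
      rw [map_add, matProj_matSection, (matProj_eq_zero_iff _).2 ⟨_, rfl⟩, add_zero]
    · change MonoidAlgebra.lift F F (matSemigroup F) 1 _ = t
      rw [map_add, MonoidAlgebra.lift_single]
      simp

theorem isCentrallyEssential_monoidAlgebra_matSemigroup (F : Type*) [Field F] :
    IsCentrallyEssential (MonoidAlgebra F (matSemigroup F)) :=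
  (isCentrallyEssential_iff_of_bijective (matProjAug F : _ →ₙ+* matAlgebra F × F)
    (matProjAug_bijective F)).2 (isCentrallyEssential_matAlgebra F).prod

theorem not_commutative_monoidAlgebra_matSemigroup (F : Type*) [Field F] :
    ¬ ∀ x y : MonoidAlgebra F (matSemigroup F), x * y = y * x := by
  intro h
  refine not_commutative_matAlgebra F fun x y => ?_
  rw [← matProj_matSection x, ← matProj_matSection y, ← map_mul, h, map_mul]

theorem not_isCancelMul_matSemigroup (F : Type*) [Field F] : ¬ IsCancelMul (matSemigroup F) := by
  intro h
  have h1 : (0 : matSemigroup F) * 1 = 0 * 0 := by rw [zero_mul, zero_mul]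
  have h2 := congrArg Subtype.val (mul_left_cancel h1)
  have h3 : (1 : Matrix (Fin 7) (Fin 7) F) = 0 := h2
  exact one_ne_zero h3

theorem zeroIdeal_ringCon_iff {F : Type*} [Field F] (x y : MonoidAlgebra F (matSemigroup F)) :
    (zeroIdeal F (matSemigroup F)).ringCon x y ↔ matProj F x = matProj F y := by
  rw [TwoSidedIdeal.rel_iff, ← sub_eq_zero (a := matProj F x), ← map_sub, matProj_eq_zero_iff]
  exact (TwoSidedIdeal.mem_mk' _ _ _ _ _ _ _).trans (exists_congr fun r => eq_comm)

/-- The isomorphism `F₀S ≅ 𝓡` induced by `matProj`. -/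
noncomputable def contractedEquivMatAlgebra (F : Type*) [Field F] :
    ContractedSemigroupAlgebra F (matSemigroup F) ≃ₐ[F] matAlgebra F :=
  AlgEquiv.ofBijective
    ((zeroIdeal F (matSemigroup F)).ringCon.liftₐ (matProj F) fun {x y} h =>
      (zeroIdeal_ringCon_iff x y).1 h) (by
    constructor
    · intro x y h
      obtain ⟨x, rfl⟩ := RingCon.mk'_surjective _ x
      obtain ⟨y, rfl⟩ := RingCon.mk'_surjective _ y
      exact (RingCon.eq _).2 ((zeroIdeal_ringCon_iff x y).2 h)
    · intro m
      exact ⟨RingCon.toQuotient (matSection F m), matProj_matSection m⟩)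

theorem coe_contractedEquivMatAlgebra_single {F : Type*} [Field F] (s : matSemigroup F) :
    (contractedEquivMatAlgebra F (RingCon.toQuotient (single s 1)) :
      Matrix (Fin 7) (Fin 7) F) = s := by
  change (matProj F (single s 1) : Matrix (Fin 7) (Fin 7) F) = s
  rw [coe_matProj_single, one_smul]

end CentEss

theorem theorem1p1 :
    (∀ (S : Type u) [Semigroup S] [IsCancelMul S] [Nonempty S] (F : Type v) [Field F],
      CentEss.IsCentrallyEssential (MonoidAlgebra F S) ↔
        ∃ (G : Type u) (_ : Group G) (ι : S →ₙ* G),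
          CentEss.IsGroupOfFractions ι ∧ CentEss.IsCentrallyEssential (MonoidAlgebra F G)) ∧
    (∀ (F : Type v) [Field F] [CharZero F],
      (¬ ∀ x y : MonoidAlgebra F (CentEss.matSemigroup F), x * y = y * x) ∧
      CentEss.IsCentrallyEssential (MonoidAlgebra F (CentEss.matSemigroup F)) ∧
      ¬ IsCancelMul (CentEss.matSemigroup F) ∧
      (¬ ∀ x y : CentEss.matAlgebra F, x * y = y * x) ∧
      CentEss.IsCentrallyEssential (CentEss.matAlgebra F) ∧
      ∃ φ : CentEss.ContractedSemigroupAlgebra F (CentEss.matSemigroup F) ≃ₐ[F]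
          CentEss.matAlgebra F,
        ∀ s : CentEss.matSemigroup F,
          ((φ (RingCon.toQuotient (MonoidAlgebra.single s 1)) : CentEss.matAlgebra F) :
            Matrix (Fin 7) (Fin 7) F) = s) :=
  ⟨fun S _ _ _ F _ => CentEss.isCentrallyEssential_iff_exists_isGroupOfFractions S F,
    fun F _ _ => ⟨CentEss.not_commutative_monoidAlgebra_matSemigroup F,
      CentEss.isCentrallyEssential_monoidAlgebra_matSemigroup F,
      CentEss.not_isCancelMul_matSemigroup F, CentEss.not_commutative_matAlgebra F,
      CentEss.isCentrallyEssential_matAlgebra F, CentEss.contractedEquivMatAlgebra F,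
      CentEss.coe_contractedEquivMatAlgebra_single⟩⟩
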